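/- A DL-Lite$_{\text{core}}$ ontology $\mathcal K$ is a finite set of inclusions $B\sqsubseteq C$ and $B\sqsubseteq\neg C$, where each of $B,C$ is a unary relation symbol $A$ or of the form $\exists P$ or $\exists P^{-1}$ for a binary relation symbol $P$, together with a finite set of assertions $A(c)$, $P(c,d)$ about constants. A Boolean conjunctive query with safe negation is a sentence $\exists \bar x\,(\alpha_1\wedge\dots\wedge\alpha_m\wedge\neg\beta_1\wedge\dots\wedge\neg\beta_n)$, where the $\alpha_i,\beta_j$ are relational atoms over the variables $\bar x$ and each variable of each $\beta_j$ occurs in some $\alpha_i$. Under the Partial Closed World Assumption, a model of $\mathcal K$ is a structure in which all inclusions and assertions of $\mathcal K$ are true and in which a fact involving only constants that occur in $\mathcal K$ is true only if it is one of the assertions of $\mathcal K$; and $\mathcal K\models\phi$ means that $\phi$ is true in every (finite or infinite) model of $\mathcal K$. Theorem. Under the Partial Closed World Assumption the following problem is undecidable: given a DL-Lite$_{\text{core}}$ ontology $\mathcal K$ and a Boolean conjunctive query with safe negation $\phi$, does $\mathcal K\models\phi$? This holds both when models are in addition required to satisfy the Unique Name Assumption (different constants occurring in $\mathcal K$ are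 interpreted as different vertices) and when they are not. -/

import Mathlib

namespace DLLite

/-! ### Syntax of DL-Lite_core

All names (unary symbols, binary symbols, constants, variables) are natural numbers. -/

/-- Names of unary relation symbols (atomic concepts). -/
abbrev ConceptName := ℕ
/-- Names of binary relation symbols (atomic roles). -/
abbrev RoleName := ℕ
/-- Names of constants (individuals). -/
abbrev ConstName := ℕ
/-- Variables of queries. -/
abbrev Var := ℕ

/-- A basic role: `P` or its inverse `P⁻¹`. -/
inductive Role where
  | atomic (P : RoleName)
  | inverse (P : RoleName)

/-- A basic concept: `A` or `∃R`, where `R` is a basic role. -/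
inductive BasicConcept where
  | atomic (A : ConceptName)
  | ex (R : Role)

/-- A concept inclusion: `B ⊑ C` or `B ⊑ ¬C`, where `B` and `C` are basic concepts. -/
inductive Inclusion where
  | pos (B C : BasicConcept)
  | neg (B C : BasicConcept)

/-- Relational atoms with arguments from `τ`: `A(t)` or `P(t, s)`.
With constants as arguments they are ground facts; with variables, atoms of queries. -/
inductive Atom (τ : Type) where
  | unary (A : ConceptName) (t : τ)
  | binary (P : RoleName) (t s : τ)

/-- The arguments of an atom. -/
def Atom.args {τ : Type} : Atom τ → List τ
  | .unary _ t => [t]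
  | .binary _ t s => [t, s]

/-- A DL-Lite_core ontology (knowledge base): finitely many concept inclusions and
finitely many assertions, which are ground facts. -/
structure Ontology where
  tbox : List Inclusion
  abox : List (Atom ConstName)

/-- The constant `c` occurs in the ontology. -/
def Ontology.Mentions (K : Ontology) (c : ConstName) : Prop :=
  ∃ α ∈ K.abox, c ∈ α.args

/-- A Boolean conjunctive query with negation: the existential closure of the conjunction of the
atoms in `pos` and of the negations of the atoms in `neg`. -/
structure Query where
  pos : List (Atom Var)
  neg : List (Atom Var)

/-- Negation is safe: each variable of a negated atom occurs in some positive atom. -/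
def Query.Safe (q : Query) : Prop :=
  ∀ α ∈ q.neg, ∀ x ∈ α.args, ∃ β ∈ q.pos, x ∈ β.args

/-! ### Semantics -/

/-- A structure with set of vertices `Δ`, together with an interpretation of the constants. -/
structure Interpretation (Δ : Type) where
  concept : ConceptName → Δ → Prop
  role : RoleName → Δ → Δ → Prop
  const : ConstName → Δ

variable {Δ : Type}

/-- The binary relation denoted by a basic role. -/
def Role.Holds (I : Interpretation Δ) : Role → Δ → Δ → Prop
  | .atomic P, d, e => I.role P d e
  | .inverse P, d, e => I.role P e d

/-- The set denoted by a basic concept. -/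
def BasicConcept.Holds (I : Interpretation Δ) : BasicConcept → Δ → Prop
  | .atomic A, d => I.concept A d
  | .ex R, d => ∃ e, R.Holds I d e

/-- Truth of a concept inclusion. -/
def Inclusion.Holds (I : Interpretation Δ) : Inclusion → Prop
  | .pos B C => ∀ d, B.Holds I d → C.Holds I d
  | .neg B C => ∀ d, B.Holds I d → ¬ C.Holds I d

/-- Truth of an atom under a valuation of its arguments. -/
def Atom.Holds {τ : Type} (I : Interpretation Δ) (v : τ → Δ) : Atom τ → Prop
  | .unary A t => I.concept A (v t)
  | .binary P t s => I.role P (v t) (v s)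

/-- Truth of a Boolean conjunctive query with negation. -/
def Query.Holds (I : Interpretation Δ) (q : Query) : Prop :=
  ∃ v : Var → Δ, (∀ α ∈ q.pos, α.Holds I v) ∧ (∀ α ∈ q.neg, ¬ α.Holds I v)

/-- All the inclusions and all the assertions of the ontology are true. -/
def Ontology.Satisfied (I : Interpretation Δ) (K : Ontology) : Prop :=
  (∀ ι ∈ K.tbox, ι.Holds I) ∧ (∀ α ∈ K.abox, α.Holds I I.const)

/-- Partial Closed World Assumption: a ground fact that involves only constants occurring in the
ontology is true only if it is one of the assertions of the ontology. -/
def PartialClosedWorld (I : Interpretation Δ) (K : Ontology) : Prop :=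
  ∀ α : Atom ConstName, (∀ c ∈ α.args, K.Mentions c) → α.Holds I I.const → α ∈ K.abox

/-- Unique Name Assumption: different constants occurring in the ontology are interpreted as
different vertices. -/
def UniqueNames (I : Interpretation Δ) (K : Ontology) : Prop :=
  ∀ c d : ConstName, K.Mentions c → K.Mentions d → I.const c = I.const d → c = d

/-- `K ⊨ q` under the Partial Closed World Assumption. -/
def Entails (K : Ontology) (q : Query) : Prop :=
  ∀ (Δ : Type) (I : Interpretation Δ),
    K.Satisfied I → PartialClosedWorld I K → q.Holds I

/-- `K ⊨ q` under the Partial Closed World Assumption and the Unique Name Assumption. -/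
def EntailsUNA (K : Ontology) (q : Query) : Prop :=
  ∀ (Δ : Type) (I : Interpretation Δ),
    K.Satisfied I → PartialClosedWorld I K → UniqueNames I K → q.Holds I

/-! ### Codings as finite data, and decidability -/

/-- Basic roles as tagged names. -/
def Role.equiv : Role ≃ RoleName ⊕ RoleName where
  toFun | .atomic P => .inl P | .inverse P => .inr P
  invFun | .inl P => .atomic P | .inr P => .inverse P
  left_inv x := by cases x <;> rfl
  right_inv x := by cases x <;> rfl

instance : Primcodable Role := Primcodable.ofEquiv _ Role.equiv

/-- Basic concepts as tagged names or basic roles. -/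
def BasicConcept.equiv : BasicConcept ≃ ConceptName ⊕ Role where
  toFun | .atomic A => .inl A | .ex R => .inr R
  invFun | .inl A => .atomic A | .inr R => .ex R
  left_inv x := by cases x <;> rfl
  right_inv x := by cases x <;> rfl

instance : Primcodable BasicConcept := Primcodable.ofEquiv _ BasicConcept.equiv

/-- Inclusions as tagged pairs of basic concepts. -/
def Inclusion.equiv :
    Inclusion ≃ (BasicConcept × BasicConcept) ⊕ (BasicConcept × BasicConcept) where
  toFun | .pos B C => .inl (B, C) | .neg B C => .inr (B, C)
  invFun | .inl (B, C) => .pos B C | .inr (B, C) => .neg B C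
  left_inv x := by cases x <;> rfl
  right_inv x := by rcases x with ⟨_, _⟩ | ⟨_, _⟩ <;> rfl

instance : Primcodable Inclusion := Primcodable.ofEquiv _ Inclusion.equiv

/-- Atoms as tagged tuples. -/
def Atom.equiv (τ : Type) : Atom τ ≃ (ConceptName × τ) ⊕ (RoleName × τ × τ) where
  toFun | .unary A t => .inl (A, t) | .binary P t s => .inr (P, t, s)
  invFun | .inl (A, t) => .unary A t | .inr (P, t, s) => .binary P t s
  left_inv x := by cases x <;> rfl
  right_inv x := by rcases x with ⟨_, _⟩ | ⟨_, _, _⟩ <;> rfl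

instance (τ : Type) [Primcodable τ] : Primcodable (Atom τ) :=
  Primcodable.ofEquiv _ (Atom.equiv τ)

/-- Ontologies as pairs of lists. -/
def Ontology.equiv : Ontology ≃ List Inclusion × List (Atom ConstName) where
  toFun K := (K.tbox, K.abox)
  invFun p := ⟨p.1, p.2⟩
  left_inv _ := rfl
  right_inv _ := rfl

instance : Primcodable Ontology := Primcodable.ofEquiv _ Ontology.equiv

/-- Queries as pairs of lists. -/
def Query.equiv : Query ≃ List (Atom Var) × List (Atom Var) where
  toFun q := (q.pos, q.neg)
  invFun p := ⟨p.1, p.2⟩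
  left_inv _ := rfl
  right_inv _ := rfl

instance : Primcodable Query := Primcodable.ofEquiv _ Query.equiv

/-- The problem "given an ontology `K` and a Boolean conjunctive query with safe negation `q`,
does `E K q` hold?" is decidable: some total computable function answers it correctly for all
such `K` and `q` (its answers for queries whose negation is not safe are irrelevant). -/
def DecidableForSafeQueries (E : Ontology → Query → Prop) : Prop :=
  ∃ f : Ontology × Query → Bool, Computable f ∧
    ∀ (K : Ontology) (q : Query), q.Safe → (f (K, q) = true ↔ E K q)

end DLLite

/-! The halting problem is reduced to entailment. For a universal code `u`, the inclusions only
force growth: the constant `root` has a zero, and every member of a context has a successor. The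
query has to say the rest, namely "some Datalog rule is violated in the context of `root`, or the
goal holds there", where the rules contain the recursion equations of `u` and the goal states that
`u` has a value at `n`. This is a disjunction, while the query must be one conjunction.

Selectors resolve this. The query conjoins the goal and the violations of all rules, each in its own
variables. The constant `sel t` links disjunct `t` to `root` and every other disjunct to frozen
constants, where the bodies and a collapsed goal are asserted and the heads, not being asserted, are
false by the closed world. So one true disjunct makes the whole query true
(`query_holds_of_violation`).

If `u` halts on `n`, a model without the query satisfies all rules along a successor chain, and
these derive the goal (`graph_of_clauses`, `entails_of_dom`). Conversely, the frozen constants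
together with the true natural numbers form a model with unique names, in which the query can hold
only if `u` halts (`countermodel_rule`, `dom_of_entailsUNA`). The first direction covers all models
and the second needs only this one, so both versions of the problem are undecidable. -/

namespace DLLite

open Nat.Partrec (Code)

/-! ### Datalog clauses over the natural numbers -/

/-- An atom `(p, s, t)` with binary predicate `p` and variables `s`, `t`. -/
abbrev Fact := ℕ × ℕ × ℕ

/-- A Datalog clause with binary predicates; the variables in `zeros` have to denote zero. -/
structure Clause where
  zeros : List ℕ
  body : List Fact
  head : Fact

/-- Truth of a clause over the natural numbers. -/
def Clause.TrueIn (ρ : ℕ → ℕ → ℕ → Prop) (C : Clause) : Prop :=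
  ∀ u : ℕ → ℕ, (∀ z ∈ C.zeros, u z = 0) → (∀ a ∈ C.body, ρ a.1 (u a.2.1) (u a.2.2)) →
    ρ C.head.1 (u C.head.2.1) (u C.head.2.2)

/-- The predicate "successor". -/
def succP : ℕ := 0
/-- The predicate "belongs to the context". -/
def ctxP : ℕ := 1
/-- The predicate "is the zero of the context". -/
def zeroP : ℕ := 2
/-- The graph of the first component of `Nat.unpair`. -/
def leftP : ℕ := 3
/-- The graph of the second component of `Nat.unpair`. -/
def rightP : ℕ := 4
/-- The predicate "less than". -/
def ltP : ℕ := 5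
/-- The graph of the partial function computed by a code. -/
def graphP (c : Code) : ℕ := Encodable.encode c + 6

/-- Clauses defining the order and the components of pairs. -/
def arithClauses : List Clause :=
  [⟨[], [(succP, 0, 1)], (ltP, 0, 1)⟩,
   ⟨[], [(ltP, 0, 1), (succP, 1, 2)], (ltP, 0, 2)⟩,
   ⟨[0], [], (leftP, 0, 0)⟩,
   ⟨[0], [], (rightP, 0, 0)⟩,
   -- The remaining clauses are the four cases of `unpair_succ`: variables `0` and `1` are a code
   -- and its successor, `2` and `3` the old components, and `4` a new component, either zero or the
   -- successor of an old one.
   ⟨[4], [(succP, 0, 1), (leftP, 0, 2), (rightP, 0, 3), (succP, 2, 3)], (leftP, 1, 3)⟩,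
   ⟨[4], [(succP, 0, 1), (leftP, 0, 2), (rightP, 0, 3), (succP, 2, 3)], (rightP, 1, 4)⟩,
   ⟨[], [(succP, 0, 1), (leftP, 0, 2), (rightP, 0, 3), (succP, 2, 4), (ltP, 4, 3)],
     (leftP, 1, 4)⟩,
   ⟨[], [(succP, 0, 1), (leftP, 0, 2), (rightP, 0, 3), (succP, 2, 4), (ltP, 4, 3)],
     (rightP, 1, 3)⟩,
   ⟨[], [(succP, 0, 1), (leftP, 0, 2), (rightP, 0, 3), (ltP, 3, 2), (succP, 3, 4)],
     (leftP, 1, 2)⟩,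
   ⟨[], [(succP, 0, 1), (leftP, 0, 2), (rightP, 0, 3), (ltP, 3, 2), (succP, 3, 4)],
     (rightP, 1, 4)⟩,
   ⟨[4], [(succP, 0, 1), (leftP, 0, 2), (rightP, 0, 2), (succP, 2, 3)], (leftP, 1, 4)⟩,
   ⟨[4], [(succP, 0, 1), (leftP, 0, 2), (rightP, 0, 2), (succP, 2, 3)], (rightP, 1, 3)⟩]

/-- Clauses defining the graphs of the functions computed by a code and by its parts. -/
def codeClauses : Code → List Clause
  | .zero => [⟨[1], [], (graphP .zero, 0, 1)⟩]
  | .succ => [⟨[], [(succP, 0, 1)], (graphP .succ, 0, 1)⟩]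
  | .left => [⟨[], [(leftP, 0, 1)], (graphP .left, 0, 1)⟩]
  | .right => [⟨[], [(rightP, 0, 1)], (graphP .right, 0, 1)⟩]
  | .pair f g =>
    ⟨[], [(graphP f, 0, 2), (graphP g, 0, 3), (leftP, 1, 2), (rightP, 1, 3)],
      (graphP (.pair f g), 0, 1)⟩ :: (codeClauses f ++ codeClauses g)
  | .comp f g =>
    ⟨[], [(graphP g, 0, 2), (graphP f, 2, 1)], (graphP (.comp f g), 0, 1)⟩ ::
      (codeClauses f ++ codeClauses g)
  | .prec f g =>
    ⟨[2], [(leftP, 0, 3), (rightP, 0, 2), (graphP f, 3, 1)], (graphP (.prec f g), 0, 1)⟩ ::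
    -- The input `0` is the pair of `2` and the successor of `3`; `6` is the previous value, taken
    -- at the pair `5` of `2` and `3`; `8` codes the triple `2`, `3`, `6` to which `g` is applied.
    ⟨[], [(leftP, 0, 2), (rightP, 0, 4), (succP, 3, 4), (leftP, 5, 2), (rightP, 5, 3),
        (graphP (.prec f g), 5, 6), (leftP, 7, 3), (rightP, 7, 6), (leftP, 8, 2), (rightP, 8, 7),
        (graphP g, 8, 1)], (graphP (.prec f g), 0, 1)⟩ ::
      (codeClauses f ++ codeClauses g)
  | .rfind' f =>
    ⟨[2], [(graphP f, 0, 2), (rightP, 0, 1)], (graphP (.rfind' f), 0, 1)⟩ ::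
    ⟨[], [(graphP f, 0, 2), (succP, 3, 2), (leftP, 0, 4), (rightP, 0, 5), (succP, 5, 6),
        (leftP, 7, 4), (rightP, 7, 6), (graphP (.rfind' f), 7, 1)],
      (graphP (.rfind' f), 0, 1)⟩ :: codeClauses f

/-- The successor of a pair in the enumeration `Nat.pair`. -/
theorem pair_succ (a b : ℕ) :
    (a + 1 = b → Nat.pair a b + 1 = Nat.pair b 0) ∧
    (a + 1 < b → Nat.pair a b + 1 = Nat.pair (a + 1) b) ∧
    (b < a → Nat.pair a b + 1 = Nat.pair a (b + 1)) ∧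
    (a = b → Nat.pair a b + 1 = Nat.pair 0 (a + 1)) := by
  refine ⟨?_, ?_, ?_, ?_⟩ <;> intro h
  · subst h; simp [Nat.pair]; ring
  · have h1 : a < b := by omega
    simp [Nat.pair, h, h1]; omega
  · have h1 : ¬ a < b := by omega
    have h2 : ¬ a < b + 1 := by omega
    simp [Nat.pair, h1, h2]; omega
  · subst h; simp [Nat.pair]; ring

/-- The successor of a code of a pair, in terms of the components. -/
theorem unpair_succ (c : ℕ) :
    (c.unpair.1 + 1 = c.unpair.2 → (c + 1).unpair = (c.unpair.2, 0)) ∧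
    (c.unpair.1 + 1 < c.unpair.2 → (c + 1).unpair = (c.unpair.1 + 1, c.unpair.2)) ∧
    (c.unpair.2 < c.unpair.1 → (c + 1).unpair = (c.unpair.1, c.unpair.2 + 1)) ∧
    (c.unpair.1 = c.unpair.2 → (c + 1).unpair = (0, c.unpair.1 + 1)) := by
  obtain ⟨h1, h2, h3, h4⟩ := pair_succ c.unpair.1 c.unpair.2
  rw [Nat.pair_unpair] at h1 h2 h3 h4
  refine ⟨fun h => ?_, fun h => ?_, fun h => ?_, fun h => ?_⟩
  · rw [h1 h, Nat.unpair_pair]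
  · rw [h2 h, Nat.unpair_pair]
  · rw [h3 h, Nat.unpair_pair]
  · rw [h4 h, Nat.unpair_pair]

/-- The intended meaning of the predicates. -/
def standard : ℕ → ℕ → ℕ → Prop
  | 0, x, y => y = x + 1
  | 1, _, _ => False
  | 2, _, _ => False
  | 3, x, y => x.unpair.1 = y
  | 4, x, y => x.unpair.2 = y
  | 5, x, y => x < y
  | k + 6, x, y => y ∈ (Denumerable.ofNat Code k).eval x

/-! ### Soundness of the clauses over the natural numbers -/

@[simp] theorem standard_succ (x y : ℕ) : standard succP x y ↔ y = x + 1 := Iff.rfl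
@[simp] theorem standard_left (x y : ℕ) : standard leftP x y ↔ x.unpair.1 = y := Iff.rfl
@[simp] theorem standard_right (x y : ℕ) : standard rightP x y ↔ x.unpair.2 = y := Iff.rfl
@[simp] theorem standard_lt (x y : ℕ) : standard ltP x y ↔ x < y := Iff.rfl
@[simp] theorem standard_graph (c : Code) (x y : ℕ) :
    standard (graphP c) x y ↔ y ∈ c.eval x := by
  simp [standard, graphP]

theorem arithClauses_standard : ∀ C ∈ arithClauses, C.TrueIn standard := by
  simp only [arithClauses, List.forall_mem_cons, Clause.TrueIn, standard_succ, standard_left,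
    standard_right, standard_lt, List.not_mem_nil, IsEmpty.forall_iff, implies_true, and_true,
    forall_const]
  refine ⟨?_, ?_, ?_, ?_, ?_, ?_, ?_, ?_, ?_, ?_, ?_, ?_⟩
  · omega
  · omega
  · intro u h; simp [h]
  · intro u h; simp [h]
  all_goals
    intro u
    have := unpair_succ (u 0)
    grind

/-- The number `n` of failed tests is made explicit because the clauses unfold the search one test
at a time: raising the starting point by one lowers `n` by one. -/
theorem mem_eval_rfind' (f : Code) (p y : ℕ) :
    y ∈ (Code.rfind' f).eval p ↔ ∃ n, y = n + p.unpair.2 ∧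
      0 ∈ f.eval (Nat.pair p.unpair.1 (n + p.unpair.2)) ∧
      ∀ k < n, ∃ v, v + 1 ∈ f.eval (Nat.pair p.unpair.1 (k + p.unpair.2)) := by
  simp only [Code.eval, Nat.unpaired, Part.mem_map_iff]
  constructor
  · rintro ⟨n, hn, rfl⟩
    obtain ⟨h0, h⟩ := Nat.mem_rfind.1 hn
    refine ⟨n, rfl, by simpa using h0, fun k hk => ?_⟩
    obtain ⟨v, hv, hv0⟩ := (Part.mem_map_iff _).1 (h hk)
    have hv1 : v ≠ 0 := by simpa using hv0
    obtain ⟨w, rfl⟩ := Nat.exists_eq_succ_of_ne_zero hv1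
    exact ⟨w, hv⟩
  · rintro ⟨n, rfl, h0, h⟩
    refine ⟨n, Nat.mem_rfind.2 ⟨by simpa using h0, fun {k} hk => ?_⟩, rfl⟩
    obtain ⟨v, hv⟩ := h k hk
    exact (Part.mem_map_iff _).2 ⟨v + 1, hv, by simp⟩

/-- Each clause is a case of the recursive definition of `Code.eval`, read from the right-hand side
to the left. -/
theorem codeClauses_standard (c : Code) : ∀ C ∈ codeClauses c, C.TrueIn standard := by
  induction c with
  | zero => simp [codeClauses, Clause.TrueIn, Code.eval, pure, PFun.pure]
  | succ => simp [codeClauses, Clause.TrueIn, Code.eval, -Prod.forall]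
  | left => simp [codeClauses, Clause.TrueIn, Code.eval, -Prod.forall, eq_comm]
  | right => simp [codeClauses, Clause.TrueIn, Code.eval, -Prod.forall, eq_comm]
  | pair f g hf hg =>
    simp only [codeClauses, List.forall_mem_cons, List.forall_mem_append]
    refine ⟨?_, hf, hg⟩
    simp only [Clause.TrueIn, List.forall_mem_cons, standard_graph, standard_left, standard_right]
    rintro u - ⟨h1, h2, h3, h4, -⟩
    simp only [Code.eval, Seq.seq, Part.mem_bind_iff, Part.map_eq_map,
      Part.mem_map_iff]
    refine ⟨_, ⟨_, h1, rfl⟩, _, h2, ?_⟩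
    rw [← h3, ← h4, Nat.pair_unpair]
  | comp f g hf hg =>
    simp only [codeClauses, List.forall_mem_cons, List.forall_mem_append]
    refine ⟨?_, hf, hg⟩
    simp only [Clause.TrueIn, List.forall_mem_cons, standard_graph]
    rintro u - ⟨h1, h2, -⟩
    exact Part.mem_bind_iff.2 ⟨_, h1, h2⟩
  | prec f g hf hg =>
    simp only [codeClauses, List.forall_mem_cons, List.forall_mem_append]
    refine ⟨?_, ?_, hf, hg⟩
    · simp only [Clause.TrueIn, List.forall_mem_cons, standard_graph, standard_left,
        standard_right]
      rintro u ⟨h0, -⟩ ⟨h1, h2, h3, -⟩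
      rw [← Nat.pair_unpair (u 0), h1, h2, h0, Code.eval_prec_zero]
      exact h3
    · simp only [Clause.TrueIn, List.forall_mem_cons, standard_graph, standard_left,
        standard_right, standard_succ]
      rintro u - ⟨h1, h2, h3, h4, h5, h6, h7, h8, h9, h10, h11, -⟩
      rw [← Nat.pair_unpair (u 0), h1, h2, h3, Code.eval_prec_succ]
      rw [← Nat.pair_unpair (u 5), h4, h5] at h6
      rw [← Nat.pair_unpair (u 8), h9, h10, ← Nat.pair_unpair (u 7), h7, h8] at h11
      exact Part.mem_bind_iff.2 ⟨_, h6, h11⟩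
  | rfind' f hf =>
    simp only [codeClauses, List.forall_mem_cons]
    refine ⟨?_, ?_, hf⟩
    · simp only [Clause.TrueIn, List.forall_mem_cons, standard_graph, standard_right]
      rintro u ⟨h0, -⟩ ⟨h1, h2, -⟩
      refine (mem_eval_rfind' f _ _).2 ⟨0, by simp [h2], ?_, by simp⟩
      rw [Nat.zero_add, Nat.pair_unpair]
      exact h0 ▸ h1
    · simp only [Clause.TrueIn, List.forall_mem_cons, standard_graph, standard_left,
        standard_right, standard_succ, mem_eval_rfind']
      rintro u - ⟨h1, h2, h3, h4, h5, h6, h7, ⟨n, h8, h9, h10⟩, -⟩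
      simp only [h6, h7, h5] at h8 h9 h10
      refine ⟨n + 1, by omega, ?_, fun k hk => ?_⟩
      · rw [h3, h4, show n + 1 + u 5 = n + (u 5 + 1) by omega]
        exact h9
      · cases k with
        | zero =>
          rw [Nat.zero_add, Nat.pair_unpair]
          exact ⟨_, h2 ▸ h1⟩
        | succ k =>
          rw [h3, h4, show k + 1 + u 5 = k + (u 5 + 1) by omega]
          exact h10 k (by omega)

/-- In a relational structure that satisfies the clauses, the predicates `leftP` and `rightP`
contain the graphs of the components of pairs. -/
theorem unpair_of_clauses {ρ : ℕ → ℕ → ℕ → Prop} (hs : ∀ n, ρ succP n (n + 1))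
    (h : ∀ C ∈ arithClauses, C.TrueIn ρ) (c : ℕ) :
    ρ leftP c c.unpair.1 ∧ ρ rightP c c.unpair.2 := by
  simp only [arithClauses, List.forall_mem_cons, Clause.TrueIn, List.not_mem_nil,
    IsEmpty.forall_iff, implies_true, and_true, forall_const] at h
  obtain ⟨h1, h2, h3, h4, h5, h6, h7, h8, h9, h10, h11, h12⟩ := h
  have hlt : ∀ m n, m < n → ρ ltP m n := by
    intro m n hmn
    induction n, hmn using Nat.le_induction with
    -- Here and below, the list gives the values of the variables of the clause in order; the
    -- default is never used, since the clause has no further variables.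
    | base => exact h1 (fun k => [m, m + 1].getD k 0) (hs m)
    | succ n _ ih => exact h2 (fun k => [m, n, n + 1].getD k 0) ⟨ih, hs n⟩
  induction c with
  | zero =>
    exact ⟨h3 (fun _ => 0) rfl, h4 (fun _ => 0) rfl⟩
  | succ c ih =>
    obtain ⟨u1, u2, u3, u4⟩ := unpair_succ c
    generalize c.unpair.1 = a at *
    generalize c.unpair.2 = b at *
    obtain ⟨il, ir⟩ := ih
    rcases lt_trichotomy a b with hab | hab | hab
    · rcases Nat.lt_or_ge (a + 1) b with hab' | hab'
      · rw [u2 hab']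
        exact ⟨h7 (fun k => [c, c + 1, a, b, a + 1].getD k 0) ⟨hs c, il, ir, hs a, hlt _ _ hab'⟩,
          h8 (fun k => [c, c + 1, a, b, a + 1].getD k 0) ⟨hs c, il, ir, hs a, hlt _ _ hab'⟩⟩
      · obtain rfl : a + 1 = b := by omega
        rw [u1 rfl]
        exact ⟨h5 (fun k => [c, c + 1, a, a + 1, 0].getD k 0) rfl ⟨hs c, il, ir, hs a⟩,
          h6 (fun k => [c, c + 1, a, a + 1, 0].getD k 0) rfl ⟨hs c, il, ir, hs a⟩⟩
    · subst hab
      rw [u4 rfl]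
      exact ⟨h11 (fun k => [c, c + 1, a, a + 1, 0].getD k 0) rfl ⟨hs c, il, ir, hs a⟩,
        h12 (fun k => [c, c + 1, a, a + 1, 0].getD k 0) rfl ⟨hs c, il, ir, hs a⟩⟩
    · rw [u3 hab]
      exact ⟨h9 (fun k => [c, c + 1, a, b, b + 1].getD k 0) ⟨hs c, il, ir, hlt _ _ hab, hs b⟩,
        h10 (fun k => [c, c + 1, a, b, b + 1].getD k 0) ⟨hs c, il, ir, hlt _ _ hab, hs b⟩⟩

/-- In a relational structure that satisfies the clauses, the predicate `graphP c` contains the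
graph of the function computed by `c`. -/
theorem graph_of_clauses {ρ : ℕ → ℕ → ℕ → Prop} (hs : ∀ n, ρ succP n (n + 1))
    (hl : ∀ p, ρ leftP p p.unpair.1) (hr : ∀ p, ρ rightP p p.unpair.2) (c : Code)
    (h : ∀ C ∈ codeClauses c, C.TrueIn ρ) (x y : ℕ) (hy : y ∈ c.eval x) :
    ρ (graphP c) x y := by
  have hl' : ∀ a b, ρ leftP (Nat.pair a b) a := fun a b => by simpa using hl (Nat.pair a b)
  have hr' : ∀ a b, ρ rightP (Nat.pair a b) b := fun a b => by simpa using hr (Nat.pair a b)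
  induction c generalizing x y with
  | zero =>
    simp only [codeClauses, List.forall_mem_cons, Clause.TrueIn, List.not_mem_nil,
      IsEmpty.forall_iff, implies_true, and_true, forall_const] at h
    obtain rfl : y = 0 := by simpa [Code.eval, pure, PFun.pure] using hy
    exact h (fun k => [x, 0].getD k 0) rfl
  | succ =>
    simp only [codeClauses, List.forall_mem_cons, Clause.TrueIn, List.not_mem_nil,
      IsEmpty.forall_iff, implies_true, and_true, forall_const] at h
    obtain rfl : y = x + 1 := by simpa [Code.eval] using hy
    exact h (fun k => [x, x + 1].getD k 0) (hs x)
  | left =>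
    simp only [codeClauses, List.forall_mem_cons, Clause.TrueIn, List.not_mem_nil,
      IsEmpty.forall_iff, implies_true, and_true, forall_const] at h
    obtain rfl : y = x.unpair.1 := by simpa [Code.eval] using hy
    exact h (fun k => [x, x.unpair.1].getD k 0) (hl x)
  | right =>
    simp only [codeClauses, List.forall_mem_cons, Clause.TrueIn, List.not_mem_nil,
      IsEmpty.forall_iff, implies_true, and_true, forall_const] at h
    obtain rfl : y = x.unpair.2 := by simpa [Code.eval] using hy
    exact h (fun k => [x, x.unpair.2].getD k 0) (hr x)
  | pair f g ihf ihg =>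
    simp only [codeClauses, List.forall_mem_cons, List.forall_mem_append] at h
    obtain ⟨h1, hf, hg⟩ := h
    simp only [Clause.TrueIn, List.forall_mem_cons, List.not_mem_nil,
      IsEmpty.forall_iff, implies_true, and_true, forall_const] at h1
    simp only [Code.eval, Seq.seq, Part.mem_bind_iff, Part.map_eq_map,
      Part.mem_map_iff] at hy
    obtain ⟨_, ⟨a, ha, rfl⟩, b, hb, rfl⟩ := hy
    exact h1 (fun k => [x, Nat.pair a b, a, b].getD k 0)
      ⟨ihf hf _ _ ha, ihg hg _ _ hb, hl' a b, hr' a b⟩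
  | comp f g ihf ihg =>
    simp only [codeClauses, List.forall_mem_cons, List.forall_mem_append] at h
    obtain ⟨h1, hf, hg⟩ := h
    simp only [Clause.TrueIn, List.forall_mem_cons, List.not_mem_nil,
      IsEmpty.forall_iff, implies_true, and_true, forall_const] at h1
    obtain ⟨a, ha, hb⟩ := Part.mem_bind_iff.1 hy
    exact h1 (fun k => [x, y, a].getD k 0) ⟨ihg hg _ _ ha, ihf hf _ _ hb⟩
  | prec f g ihf ihg =>
    simp only [codeClauses, List.forall_mem_cons, List.forall_mem_append] at h
    obtain ⟨h1, h2, hf, hg⟩ := h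
    simp only [Clause.TrueIn, List.forall_mem_cons, List.not_mem_nil,
      IsEmpty.forall_iff, implies_true, and_true, forall_const] at h1 h2
    rw [← Nat.pair_unpair x] at hy ⊢
    generalize x.unpair.1 = a at *
    generalize x.unpair.2 = n at *
    induction n generalizing y with
    | zero =>
      rw [Code.eval_prec_zero] at hy
      exact h1 (fun k => [Nat.pair a 0, y, 0, a].getD k 0) rfl
        ⟨hl' a 0, hr' a 0, ihf hf _ _ hy⟩
    | succ n ih =>
      rw [Code.eval_prec_succ] at hy
      obtain ⟨i, hi, hy⟩ := Part.mem_bind_iff.1 hy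
      exact h2 (fun k => [Nat.pair a (n + 1), y, a, n, n + 1, Nat.pair a n, i, Nat.pair n i,
        Nat.pair a (Nat.pair n i)].getD k 0)
        ⟨hl' _ _, hr' _ _, hs n, hl' _ _, hr' _ _, ih _ hi, hl' _ _, hr' _ _, hl' _ _, hr' _ _,
          ihg hg _ _ hy⟩
  | rfind' f ihf =>
    simp only [codeClauses, List.forall_mem_cons] at h
    obtain ⟨h1, h2, hf⟩ := h
    simp only [Clause.TrueIn, List.forall_mem_cons, List.not_mem_nil,
      IsEmpty.forall_iff, implies_true, and_true, forall_const] at h1 h2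
    obtain ⟨n, rfl, h0, hn⟩ := (mem_eval_rfind' f _ _).1 hy
    clear hy
    rw [← Nat.pair_unpair x]
    generalize x.unpair.1 = a at *
    generalize x.unpair.2 = m at *
    rw [Nat.unpair_pair]
    induction n generalizing m with
    | zero =>
      rw [Nat.zero_add] at h0 ⊢
      exact h1 (fun k => [Nat.pair a m, m, 0].getD k 0) rfl ⟨ihf hf _ _ h0, hr' _ _⟩
    | succ n ih =>
      obtain ⟨v, hv⟩ := hn 0 (by omega)
      rw [Nat.zero_add] at hv
      have key := ih (m + 1) (by rwa [show n + (m + 1) = n + 1 + m by omega]) fun k hk => by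
        rw [show k + (m + 1) = k + 1 + m by omega]
        exact hn (k + 1) (by omega)
      dsimp only at key ⊢
      rw [show n + (m + 1) = n + 1 + m by omega] at key
      exact h2 (fun k => [Nat.pair a m, n + 1 + m, v + 1, v, a, m, m + 1,
        Nat.pair a (m + 1)].getD k 0)
        ⟨ihf hf _ _ hv, hs v, hl' _ _, hr' _ _, hs m, hl' _ _, hr' _ _, key⟩

/-! ### From clauses to an ontology and a query -/

/-- A rule is a list of body atoms and a head atom; its variable `0` denotes the context. -/
abbrev Rule := List Fact × Fact

/-- The rule that states a clause about the elements of the context. -/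
def Clause.guard (C : Clause) : Rule :=
  (C.zeros.map (fun z => (zeroP, 0, z + 1)) ++
      C.body.map (fun a => (a.1, a.2.1 + 1, a.2.2 + 1)) ++
      -- Guarding the head variables as well makes the negated head safe.
      (C.head :: C.body).flatMap (fun a => [(ctxP, 0, a.2.1 + 1), (ctxP, 0, a.2.2 + 1)]),
    (C.head.1, C.head.2.1 + 1, C.head.2.2 + 1))

/-- The zero belongs to the context, and the context is closed under successors. -/
def contextRules : List Rule :=
  [([(zeroP, 0, 1)], (ctxP, 0, 1)), ([(ctxP, 0, 1), (succP, 1, 2)], (ctxP, 0, 2))]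

/-- All the rules for the function computed by a code. -/
def rules (u : Code) : List Rule :=
  contextRules ++ (arithClauses ++ codeClauses u).map Clause.guard

/-- The tag of a rule; the tag `0` is reserved for the goal. -/
def Rule.tag (r : Rule) : ℕ := Encodable.encode r + 1

theorem Rule.tag_injective : Function.Injective Rule.tag := fun _ _ h =>
  Encodable.encode_injective (Nat.succ_injective h)

/-- The tags of all the rules and of the goal. -/
def tags (u : Code) : List ℕ := 0 :: (rules u).map Rule.tag

/-- The role name that stands for a predicate. -/
def predRole (p : ℕ) : RoleName := 2 * p
/-- The role name that links a selector to the context of the rule with tag `t`. -/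
def selRole (t : ℕ) : RoleName := 2 * t + 1

/-- The context: a constant. As a query variable, this name stands for the selector. -/
def root : ℕ := Nat.pair 0 0
/-- The selector of the rule with tag `t`. -/
def sel (t : ℕ) : ConstName := Nat.pair 0 (t + 1)
/-- The copy of the variable `k` for the rule with tag `t`, as a query variable or a constant. -/
def copy (t k : ℕ) : ℕ := Nat.pair (t + 1) k

@[simp] theorem copy_inj {t k t' k' : ℕ} : copy t k = copy t' k' ↔ t = t' ∧ k = k' := by
  simp [copy, Nat.pair_eq_pair]
@[simp] theorem sel_inj {t t' : ℕ} : sel t = sel t' ↔ t = t' := by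
  simp [sel, Nat.pair_eq_pair]
@[simp] theorem copy_ne_root {t k : ℕ} : copy t k ≠ root := by
  simp [copy, root, Nat.pair_eq_pair]
@[simp] theorem predRole_inj {p p' : ℕ} : predRole p = predRole p' ↔ p = p' := by
  simp [predRole]
@[simp] theorem selRole_inj {p p' : ℕ} : selRole p = selRole p' ↔ p = p' := by
  simp [selRole]
@[simp] theorem predRole_ne_selRole {p p' : ℕ} : predRole p ≠ selRole p' := by
  intro h
  have : 2 * p = 2 * p' + 1 := h
  omega
@[simp] theorem selRole_ne_predRole {p p' : ℕ} : selRole p' ≠ predRole p :=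
  predRole_ne_selRole.symm

/-- The copy of an atom for the rule with tag `t`. -/
def Fact.copy (t : ℕ) (a : Fact) : Atom ℕ :=
  .binary (predRole a.1) (DLLite.copy t a.2.1) (DLLite.copy t a.2.2)

/-- The goal: the function computed by `u` has a value at `n`. -/
def goal (u : Code) (n : ℕ) : List Fact :=
  (zeroP, 0, 2) :: (graphP u, n + 2, 1) :: (List.range n).map fun i => (succP, i + 2, i + 3)

/-- The goal with all its variables identified. -/
def collapsedGoal (u : Code) : List Fact := [(zeroP, 0, 0), (graphP u, 0, 0), (succP, 0, 0)]

/-- The assertions: frozen bodies of the rules, with selectors that choose one rule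
to be applied in the context and frozen bodies for the other rules. -/
def assertions (u : Code) : List (Atom ConstName) :=
  .unary 0 root :: ((collapsedGoal u).map (Fact.copy 0) ++
    (rules u).flatMap (fun r => r.1.map (Fact.copy r.tag)) ++
    (tags u).flatMap fun i => (tags u).map fun j =>
      .binary (selRole j) (sel i) (if i = j then root else copy j 0))

/-- The ontology of a code. -/
def ontology (u : Code) : Ontology where
  tbox := [.pos (.atomic 0) (.ex (.atomic (predRole zeroP))),
    .pos (.ex (.inverse (predRole ctxP))) (.ex (.atomic (predRole succP)))]
  abox := assertions u

/-- The query that is true when a rule is violated or the function computed by `u` has a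
value at `n`. -/
def query (u : Code) (n : ℕ) : Query where
  pos := (goal u n).map (Fact.copy 0) ++
    ((rules u).flatMap (fun r => r.1.map (Fact.copy r.tag)) ++
    (tags u).map fun j => .binary (selRole j) root (copy j 0))
  neg := (rules u).map fun r => r.2.copy r.tag

/-! ### Safety of the query and falsity of the frozen heads -/

theorem binary_mem_assertions (u : Code) (p : RoleName) (c d : ConstName) :
    .binary p c d ∈ assertions u ↔
      (∃ a ∈ collapsedGoal u, a.copy 0 = .binary p c d) ∨
      (∃ r ∈ rules u, ∃ a ∈ r.1, a.copy r.tag = .binary p c d) ∨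
      ∃ i ∈ tags u, ∃ j ∈ tags u,
        selRole j = p ∧ sel i = c ∧ (if i = j then root else copy j 0) = d := by
  simp only [assertions, List.mem_cons, List.mem_append, List.mem_map, List.mem_flatMap,
    reduceCtorEq, false_or, Atom.binary.injEq, or_assoc]

theorem unary_mem_assertions (u : Code) (A : ConceptName) (c : ConstName) :
    .unary A c ∈ assertions u ↔ A = 0 ∧ c = root := by
  simp [assertions, Fact.copy]

/-- Every variable of the head of a rule occurs in its body. -/
theorem head_occurs {u : Code} {r : Rule} (hr : r ∈ rules u) :
    ∀ x, x = r.2.2.1 ∨ x = r.2.2.2 → ∃ a ∈ r.1, x = a.2.1 ∨ x = a.2.2 := by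
  intro x hx
  simp only [rules, List.mem_append (s := contextRules), List.mem_map] at hr
  rcases hr with hr | ⟨C, -, rfl⟩
  · simp only [contextRules, List.mem_cons, List.not_mem_nil, or_false] at hr
    rcases hr with rfl | rfl
    · exact ⟨_, List.mem_cons_self, hx⟩
    · rcases hx with rfl | rfl
      · exact ⟨_, List.mem_cons_self, Or.inl rfl⟩
      · exact ⟨(succP, 1, 2), by simp, Or.inr rfl⟩
  · rcases hx with rfl | rfl
    · exact ⟨(ctxP, 0, C.head.2.1 + 1), by simp [Clause.guard], Or.inr rfl⟩
    · exact ⟨(ctxP, 0, C.head.2.2 + 1), by simp [Clause.guard], Or.inr rfl⟩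

theorem query_safe (u : Code) (n : ℕ) : (query u n).Safe := by
  intro α hα x hx
  simp only [query, List.mem_map] at hα
  obtain ⟨r, hr, rfl⟩ := hα
  have hx' : x = copy r.tag r.2.2.1 ∨ x = copy r.tag r.2.2.2 := by
    simpa [Fact.copy, Atom.args] using hx
  have key : ∀ k, k = r.2.2.1 ∨ k = r.2.2.2 →
      ∃ β ∈ (query u n).pos, copy r.tag k ∈ β.args := by
    intro k hk
    obtain ⟨a, ha, hka⟩ := head_occurs hr k hk
    refine ⟨a.copy r.tag, ?_, ?_⟩
    · simp only [query, List.mem_append, List.mem_flatMap, List.mem_map]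
      exact Or.inr (Or.inl ⟨r, hr, a, ha, rfl⟩)
    · simpa [Fact.copy, Atom.args] using hka
  rcases hx' with rfl | rfl
  · exact key _ (Or.inl rfl)
  · exact key _ (Or.inr rfl)

/-- The atoms added by the guard have predicate `zeroP` or `ctxP`, so the head could only coincide
with a shifted atom of the original body. -/
theorem head_notMem_body {C : Clause} (h1 : C.head.1 ≠ ctxP) (h2 : C.head.1 ≠ zeroP)
    (h3 : C.head ∉ C.body) : C.guard.2 ∉ C.guard.1 := by
  obtain ⟨zs, B, p, s, t⟩ := C
  simp only [Clause.guard, List.mem_append, List.mem_map, List.mem_flatMap, List.mem_cons,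
    List.not_mem_nil, Prod.mk.injEq] at *
  rintro ((⟨z, -, h, -⟩ | ⟨⟨p', s', t'⟩, ha, rfl, h, h'⟩) | ⟨a, -, ⟨h, -⟩ | ⟨h, -⟩ | h⟩)
  · exact h2 h.symm
  · obtain rfl : s' = s := by simpa using h
    obtain rfl : t' = t := by simpa using h'
    exact h3 ha
  · exact h1 h
  · exact h1 h
  · exact h

/-- No rule is a tautology. -/
theorem rule_nontrivial {u : Code} {r : Rule} (hr : r ∈ rules u) : r.2 ∉ r.1 := by
  have harith : ∀ C ∈ arithClauses, C.head.1 ≠ ctxP ∧ C.head.1 ≠ zeroP ∧ C.head ∉ C.body := by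
    decide
  -- A recursive clause has its own predicate in the body, but with a first variable other than `0`.
  have hcode : ∀ C ∈ codeClauses u, C.head.1 ≠ ctxP ∧ C.head.1 ≠ zeroP ∧ C.head ∉ C.body := by
    clear hr
    induction u <;>
      simp_all [codeClauses, graphP, ctxP, zeroP, succP, leftP, rightP, or_imp, forall_and]
  simp only [rules, List.mem_append (s := contextRules), List.mem_map] at hr
  rcases hr with hr | ⟨C, hC, rfl⟩
  · revert r
    decide
  · obtain ⟨h1, h2, h3⟩ := (List.mem_append.1 hC).elim (harith C) (hcode C)
    exact head_notMem_body h1 h2 h3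

/-- The head of a frozen rule is not asserted. -/
theorem head_notMem_assertions {u : Code} {r : Rule} (hr : r ∈ rules u) :
    r.2.copy r.tag ∉ assertions u := by
  rw [Fact.copy, binary_mem_assertions]
  rintro (⟨a, -, h⟩ | ⟨r', hr', a, ha, h⟩ | ⟨i, -, j, -, h, -⟩)
  · simp [Fact.copy, Rule.tag] at h
  · simp only [Fact.copy, Atom.binary.injEq, predRole_inj, copy_inj] at h
    obtain ⟨h1, ⟨h2, h3⟩, -, h4⟩ := h
    obtain rfl := Rule.tag_injective h2
    have : a = r'.2 := Prod.ext h1 (Prod.ext h3 h4)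
    exact rule_nontrivial hr (this ▸ ha)
  · exact selRole_ne_predRole h

/-! ### Entailment -/

/-- Truth of an atom in an interpretation, under a valuation. -/
def Fact.Holds {Δ : Type} (I : Interpretation Δ) (v : ℕ → Δ) (a : Fact) : Prop :=
  I.role (predRole a.1) (v a.2.1) (v a.2.2)

/-- A rule violated in the context, or the goal, makes the query true: the selector takes care
of the other rules. -/
theorem query_holds_of_violation {Δ : Type} {I : Interpretation Δ} {u : Code} {n : ℕ}
    (hI : (ontology u).Satisfied I) (hP : PartialClosedWorld I (ontology u))
    {t : ℕ} (ht : t ∈ tags u) (v : ℕ → Δ) (hv : v 0 = I.const root)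
    (hgoal : t = 0 → ∀ a ∈ goal u n, a.Holds I v)
    (hrule : ∀ r ∈ rules u, r.tag = t → (∀ a ∈ r.1, a.Holds I v) ∧ ¬ r.2.Holds I v) :
    (query u n).Holds I := by
  have hA : ∀ α ∈ assertions u, α.Holds I I.const := hI.2
  have hne : ∀ r : Rule, r.tag ≠ 0 := fun r => Nat.succ_ne_zero _
  -- Disjunct `t` is evaluated by `v`, the other rules at their frozen copies. An unselected goal
  -- collapses to the single constant `copy 0 0`, so that the assertions need not depend on `n`.
  let V : ℕ → Δ := fun x =>
    if x = root then I.const (sel t)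
    else if x.unpair.1 = t + 1 then v x.unpair.2
    else if x.unpair.1 = 1 then I.const (copy 0 0)
    else I.const x
  have hVroot : V root = I.const (sel t) := by simp [V]
  have hVself : ∀ k, V (copy t k) = v k := by
    intro k
    simp only [V, copy_ne_root, if_false]
    simp [copy]
  have hVgoal : t ≠ 0 → ∀ k, V (copy 0 k) = I.const (copy 0 0) := by
    intro h k
    simp only [V, copy_ne_root, if_false]
    simp [copy, h]
  have hVother : ∀ s, s ≠ t → s ≠ 0 → ∀ k, V (copy s k) = I.const (copy s k) := by
    intro s h h0 k
    simp only [V, copy_ne_root, if_false]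
    simp [copy, h, h0]
  have hself : ∀ a : Fact, (a.copy t).Holds I V ↔ a.Holds I v := by
    intro a
    simp only [Fact.copy, Atom.Holds, hVself, Fact.Holds]
  have hother : ∀ s, s ≠ t → s ≠ 0 → ∀ a : Fact,
      (a.copy s).Holds I V ↔ (a.copy s).Holds I I.const := by
    intro s h h0 a
    simp only [Fact.copy, Atom.Holds, hVother s h h0]
  refine ⟨V, fun α hα => ?_, fun α hα => ?_⟩
  · simp only [query, List.mem_append, List.mem_map, List.mem_flatMap] at hα
    rcases hα with ⟨a, ha, rfl⟩ | ⟨r, hr, a, ha, rfl⟩ | ⟨j, hj, rfl⟩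
    · rcases eq_or_ne t 0 with h0 | h0
      · have := hgoal h0 a ha
        subst h0
        exact (hself a).2 this
      · have hmem : (a.1, 0, 0) ∈ collapsedGoal u := by
          simp only [goal, List.mem_cons, List.mem_map] at ha
          rcases ha with rfl | rfl | ⟨i, -, rfl⟩ <;> simp [collapsedGoal]
        have := hA (Fact.copy 0 (a.1, 0, 0)) (by
          rw [Fact.copy, binary_mem_assertions]
          exact Or.inl ⟨_, hmem, rfl⟩)
        simpa only [Fact.copy, Atom.Holds, hVgoal h0] using this
    · rcases eq_or_ne r.tag t with h | h
      · rw [h]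
        exact (hself a).2 ((hrule r hr h).1 a ha)
      · refine (hother _ h (hne r) a).2 (hA _ ?_)
        rw [Fact.copy, binary_mem_assertions]
        exact Or.inr (Or.inl ⟨r, hr, a, ha, rfl⟩)
    · simp only [Atom.Holds, hVroot]
      have := hA (.binary (selRole j) (sel t) (if t = j then root else copy j 0)) (by
        rw [binary_mem_assertions]
        exact Or.inr (Or.inr ⟨t, ht, j, hj, rfl, rfl, rfl⟩))
      simp only [Atom.Holds] at this
      rcases eq_or_ne j t with rfl | h
      · rw [hVself, hv]
        simpa using this
      · rw [if_neg h.symm] at this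
        rcases eq_or_ne j 0 with rfl | h0
        · rwa [hVgoal h.symm]
        · rwa [hVother j h h0]
  · simp only [query, List.mem_map] at hα
    obtain ⟨r, hr, rfl⟩ := hα
    rcases eq_or_ne r.tag t with h | h
    · rw [h, hself]
      exact (hrule r hr h).2
    · rw [hother _ h (hne r)]
      intro hc
      refine head_notMem_assertions hr (hP _ (fun c hc' => ?_) hc)
      have hc'' : c = copy r.tag r.2.2.1 ∨ c = copy r.tag r.2.2.2 := by
        simpa [Fact.copy, Atom.args] using hc'
      have key : ∀ k, k = r.2.2.1 ∨ k = r.2.2.2 → (ontology u).Mentions (copy r.tag k) := by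
        intro k hk
        obtain ⟨a, ha, hka⟩ := head_occurs hr k hk
        refine ⟨a.copy r.tag, ?_, ?_⟩
        · change _ ∈ assertions u
          rw [Fact.copy, binary_mem_assertions]
          exact Or.inr (Or.inl ⟨r, hr, a, ha, rfl⟩)
        · simpa [Fact.copy, Atom.args] using hka
      rcases hc'' with rfl | rfl
      · exact key _ (Or.inl rfl)
      · exact key _ (Or.inr rfl)

theorem entails_of_dom (u : Code) (n : ℕ) (h : (u.eval n).Dom) :
    Entails (ontology u) (query u n) := by
  intro Δ I hI hP
  by_contra hq
  have hrule : ∀ r ∈ rules u, ∀ v : ℕ → Δ, v 0 = I.const root → (∀ a ∈ r.1, a.Holds I v) →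
      r.2.Holds I v := by
    intro r hr v hv hb
    by_contra hh
    refine hq (query_holds_of_violation hI hP (t := r.tag)
      (List.mem_cons_of_mem _ (List.mem_map_of_mem hr)) v hv (fun h0 => absurd h0 (by
        simp [Rule.tag])) fun r' _ h' => ?_)
    rw [Rule.tag_injective h']
    exact ⟨hb, hh⟩
  have hzero : ∀ d, I.role (predRole zeroP) (I.const root) d →
      I.role (predRole ctxP) (I.const root) d := by
    intro d hd
    have := hrule ([(zeroP, 0, 1)], (ctxP, 0, 1)) (by simp [rules, contextRules])
      (fun k => [I.const root, d].getD k d) rfl (by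
        intro a ha
        obtain rfl := List.mem_singleton.1 ha
        exact hd)
    exact this
  have hstep : ∀ d e, I.role (predRole ctxP) (I.const root) d → I.role (predRole succP) d e →
      I.role (predRole ctxP) (I.const root) e := by
    intro d e hd he
    have := hrule ([(ctxP, 0, 1), (succP, 1, 2)], (ctxP, 0, 2)) (by simp [rules, contextRules])
      (fun k => [I.const root, d, e].getD k d) rfl (by
        simp only [List.forall_mem_cons]
        exact ⟨hd, he, by simp⟩)
    exact this
  obtain ⟨z, hz⟩ : ∃ z, I.role (predRole zeroP) (I.const root) z :=
    hI.1 (.pos (.atomic 0) (.ex (.atomic (predRole zeroP)))) List.mem_cons_self (I.const root)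
      (hI.2 (.unary 0 root) ((unary_mem_assertions u 0 root).2 ⟨rfl, rfl⟩))
  have hnext : ∀ d, I.role (predRole ctxP) (I.const root) d → ∃ e, I.role (predRole succP) d e :=
    fun d hd => hI.1 (.pos (.ex (.inverse (predRole ctxP))) (.ex (.atomic (predRole succP))))
      (List.mem_cons_of_mem _ List.mem_cons_self) d ⟨_, hd⟩
  choose! next hnext using hnext
  let e : ℕ → Δ := fun k => next^[k] z
  have hctx : ∀ k, I.role (predRole ctxP) (I.const root) (e k) := by
    intro k
    induction k with
    | zero => exact hzero z hz
    | succ k ih =>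
      simp only [e, Function.iterate_succ_apply']
      exact hstep _ _ ih (hnext _ ih)
  have hsucc : ∀ k, I.role (predRole succP) (e k) (e (k + 1)) := by
    intro k
    have := hnext _ (hctx k)
    simpa only [e, Function.iterate_succ_apply'] using this
  -- The roles are pulled back along `e` to relations on the natural numbers. The chain may repeat
  -- vertices: only the presence of derived facts is needed.
  have hclause : ∀ C ∈ arithClauses ++ codeClauses u,
      C.TrueIn fun p x y => I.role (predRole p) (e x) (e y) := by
    intro C hC w hw hb
    refine hrule C.guard (List.mem_append_right _ (List.mem_map_of_mem hC))
      (fun k => k.casesOn (I.const root) fun k => e (w k)) rfl fun a ha => ?_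
    simp only [Clause.guard, List.mem_append, List.mem_map, List.mem_flatMap] at ha
    rcases ha with (⟨s, hs, rfl⟩ | ⟨b, hb', rfl⟩) | ⟨b, -, hb'⟩
    · change I.role (predRole zeroP) (I.const root) (e (w s))
      rw [hw s hs]
      exact hz
    · exact hb b hb'
    · simp only [List.mem_cons, List.not_mem_nil, or_false] at hb'
      rcases hb' with rfl | rfl
      · exact hctx _
      · exact hctx _
  have hunpair := unpair_of_clauses hsucc fun C hC => hclause C (List.mem_append_left _ hC)
  have hgraph := graph_of_clauses hsucc (fun p => (hunpair p).1) (fun p => (hunpair p).2) u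
    (fun C hC => hclause C (List.mem_append_right _ hC)) n _ (Part.get_mem h)
  -- Variable `0` is the context, `1` the computed value, and `k + 2` the numeral `k`.
  refine hq (query_holds_of_violation hI hP (t := 0) List.mem_cons_self
    (fun k => k.casesOn (I.const root) fun k => k.casesOn (e ((u.eval n).get h)) e) rfl
    (fun _ a ha => ?_) fun r _ h0 => absurd h0 (by simp [Rule.tag]))
  simp only [goal, List.mem_cons, List.mem_map] at ha
  rcases ha with rfl | rfl | ⟨i, -, rfl⟩
  · exact hz
  · exact hgraph
  · exact hsucc i

/-! ### The countermodel -/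

/-- The constants, where exactly the assertions are true, together with a copy of the natural
numbers, which forms the context. -/
def countermodel (u : Code) : Interpretation (ℕ ⊕ ℕ) where
  concept
    | A, .inl c => .unary A c ∈ assertions u
    | _, .inr _ => False
  role
    | P, .inl c, .inl d => .binary P c d ∈ assertions u
    -- Frozen bodies assert `ctxP` of constants, so the second inclusion demands successors of them;
    -- every constant receives the number `0`.
    | P, .inl c, .inr n => P = predRole succP ∧ n = 0 ∨ P = predRole ctxP ∧ c = root ∨
        P = predRole zeroP ∧ c = root ∧ n = 0
    | P, .inr m, .inr n => ∃ p, P = predRole p ∧ standard p m n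
    | _, .inr _, .inl _ => False
  const := .inl

theorem countermodel_satisfied (u : Code) : (ontology u).Satisfied (countermodel u) := by
  refine ⟨?_, ?_⟩
  · simp only [ontology, List.forall_mem_cons, List.not_mem_nil, IsEmpty.forall_iff,
      implies_true, and_true]
    constructor
    · rintro (c | m) h
      · obtain ⟨-, rfl⟩ := (unary_mem_assertions u 0 c).1 h
        exact ⟨.inr 0, Or.inr (Or.inr ⟨rfl, rfl, rfl⟩)⟩
      · exact h.elim
    · rintro (c | m) -
      · exact ⟨.inr 0, Or.inl ⟨rfl, rfl⟩⟩
      · exact ⟨.inr (m + 1), succP, rfl, rfl⟩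
  · rintro (⟨A, c⟩ | ⟨P, c, d⟩) h
    · exact h
    · exact h

theorem countermodel_closed (u : Code) :
    PartialClosedWorld (countermodel u) (ontology u) := by
  rintro (⟨A, c⟩ | ⟨P, c, d⟩) - h
  · exact h
  · exact h

/-- The context has no assertions about predicates. -/
theorem root_notMem (u : Code) (p : ℕ) (d : ConstName) :
    .binary (predRole p) root d ∉ assertions u := by
  rw [binary_mem_assertions]
  rintro (⟨a, -, h⟩ | ⟨r, -, a, -, h⟩ | ⟨i, -, j, -, h, -⟩)
  · simp [Fact.copy] at h
  · simp [Fact.copy] at h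
  · exact selRole_ne_predRole h

theorem countermodel_zero {u : Code} {d : ℕ ⊕ ℕ}
    (h : (countermodel u).role (predRole zeroP) (.inl root) d) : d = .inr 0 := by
  rcases d with d | m
  · exact absurd h (root_notMem u _ _)
  · simpa [countermodel, succP, ctxP, zeroP] using h

theorem countermodel_ctx {u : Code} {d : ℕ ⊕ ℕ}
    (h : (countermodel u).role (predRole ctxP) (.inl root) d) : ∃ m, d = .inr m := by
  rcases d with d | m
  · exact absurd h (root_notMem u _ _)
  · exact ⟨m, rfl⟩

theorem countermodel_standard {u : Code} {p m n : ℕ} :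
    (countermodel u).role (predRole p) (.inr m) (.inr n) ↔ standard p m n := by
  simp [countermodel]

theorem countermodel_succ {u : Code} {m : ℕ} {d : ℕ ⊕ ℕ}
    (h : (countermodel u).role (predRole succP) (.inr m) d) : d = .inr (m + 1) := by
  rcases d with d | n
  · exact h.elim
  · rw [countermodel_standard, standard_succ] at h
    rw [h]

/-- In the countermodel, all the rules are true in the context. -/
theorem countermodel_rule {u : Code} {r : Rule} (hr : r ∈ rules u) (v : ℕ → ℕ ⊕ ℕ)
    (hv : v 0 = .inl root) (hb : ∀ a ∈ r.1, a.Holds (countermodel u) v) :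
    r.2.Holds (countermodel u) v := by
  simp only [rules, List.mem_append (s := contextRules), List.mem_map] at hr
  rcases hr with hr | ⟨C, hC, rfl⟩
  · simp only [contextRules, List.mem_cons, List.not_mem_nil, or_false] at hr
    rcases hr with rfl | rfl
    · simp only [List.forall_mem_cons, Fact.Holds, hv] at hb ⊢
      rw [countermodel_zero hb.1]
      exact Or.inr (Or.inl ⟨rfl, rfl⟩)
    · simp only [List.forall_mem_cons, Fact.Holds, hv] at hb ⊢
      obtain ⟨m, hm⟩ := countermodel_ctx hb.1
      rw [hm] at hb
      rw [countermodel_succ hb.2.1]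
      exact Or.inr (Or.inl ⟨rfl, rfl⟩)
  · have hz : ∀ z ∈ C.zeros, v (z + 1) = .inr 0 := by
      intro z hz
      have := hb (zeroP, 0, z + 1) (by
        simp only [Clause.guard, List.mem_append, List.mem_map]
        exact Or.inl (Or.inl ⟨z, hz, rfl⟩))
      simp only [Fact.Holds, hv] at this
      exact countermodel_zero this
    -- The value on constants is immaterial: the guards force every variable of the clause to denote
    -- a number.
    let w : ℕ → ℕ := fun k => (v (k + 1)).elim (fun _ => 0) id
    have hvar : ∀ a ∈ C.head :: C.body,
        v (a.2.1 + 1) = .inr (w a.2.1) ∧ v (a.2.2 + 1) = .inr (w a.2.2) := by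
      intro a ha
      have hctx : ∀ k, k = a.2.1 ∨ k = a.2.2 → v (k + 1) = .inr (w k) := by
        intro k hk
        have := hb (ctxP, 0, k + 1) (by
          simp only [Clause.guard, List.mem_append, List.mem_flatMap]
          refine Or.inr ⟨a, ha, ?_⟩
          rcases hk with rfl | rfl <;> simp)
        simp only [Fact.Holds, hv] at this
        obtain ⟨m, hm⟩ := countermodel_ctx this
        simp [w, hm]
      exact ⟨hctx _ (Or.inl rfl), hctx _ (Or.inr rfl)⟩
    have htrue : C.TrueIn standard := by
      rcases List.mem_append.1 hC with h | h
      · exact arithClauses_standard C h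
      · exact codeClauses_standard u C h
    have := htrue w (fun z h => by simp [w, hz z h]) fun a ha => by
      have hva := hvar a (List.mem_cons_of_mem _ ha)
      have := hb (a.1, a.2.1 + 1, a.2.2 + 1) (by
        simp only [Clause.guard, List.mem_append, List.mem_map]
        exact Or.inl (Or.inr ⟨a, ha, rfl⟩))
      simpa only [Fact.Holds, hva.1, hva.2, countermodel_standard] using this
    have hva := hvar C.head List.mem_cons_self
    simpa only [Clause.guard, Fact.Holds, hva.1, hva.2, countermodel_standard] using this

/-- Selector roles hold only between constants, so a match in the countermodel picks some `sel t`
and puts disjunct `t` at `root`. A rule cannot be violated there, hence `t = 0`; the numerals of the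
goal are then the true numbers and its value is a true value. -/
theorem dom_of_entailsUNA (u : Code) (n : ℕ) (h : EntailsUNA (ontology u) (query u n)) :
    (u.eval n).Dom := by
  obtain ⟨v, hpos, hneg⟩ := h _ (countermodel u) (countermodel_satisfied u)
    (countermodel_closed u) fun c d _ _ hcd => Sum.inl.inj hcd
  simp only [query, List.forall_mem_append, List.forall_mem_map, List.forall_mem_flatMap] at *
  obtain ⟨hgoal, hbody, hsel⟩ := hpos
  have hsel' : ∀ j ∈ tags u, ∃ c d, v root = .inl c ∧ v (copy j 0) = .inl d ∧
      .binary (selRole j) c d ∈ assertions u := by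
    intro j hj
    have := hsel j hj
    simp only [Atom.Holds] at this
    generalize v root = x at this ⊢
    generalize v (copy j 0) = y at this ⊢
    rcases x with c | m <;> rcases y with d | m'
    · exact ⟨c, d, rfl, rfl, this⟩
    · simp [countermodel] at this
    · exact this.elim
    · simp [countermodel] at this
  have hsel'' : ∀ j ∈ tags u, ∃ i ∈ tags u, v root = .inl (sel i) ∧
      v (copy j 0) = .inl (if i = j then root else copy j 0) := by
    intro j hj
    obtain ⟨c, d, hc, hd, hm⟩ := hsel' j hj
    rw [binary_mem_assertions] at hm
    rcases hm with ⟨a, -, h⟩ | ⟨r, -, a, -, h⟩ | ⟨i, hi, j', -, h, rfl, rfl⟩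
    · simp [Fact.copy] at h
    · simp [Fact.copy] at h
    · obtain rfl := selRole_inj.1 h
      exact ⟨i, hi, hc, hd⟩
  -- Tag `0` serves only to identify the selector; its link for its own tag `t` then leads to
  -- `root`.
  obtain ⟨t, ht, hvt, -⟩ := hsel'' 0 List.mem_cons_self
  obtain ⟨i, hi, hvi, hroot⟩ := hsel'' t ht
  obtain rfl : t = i := by simpa [hvt] using hvi
  rw [if_pos rfl] at hroot
  rcases List.mem_cons.1 ht with rfl | ht'
  · have hg : ∀ a ∈ goal u n, a.Holds (countermodel u) fun k => v (copy 0 k) := hgoal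
    simp only [goal, List.forall_mem_cons, List.forall_mem_map, Fact.Holds, hroot] at hg
    obtain ⟨hz, hu, hs⟩ := hg
    have hnum : ∀ k ≤ n, v (copy 0 (k + 2)) = .inr k := by
      intro k hk
      induction k with
      | zero => exact countermodel_zero hz
      | succ k ih =>
        have := hs k (List.mem_range.2 hk)
        rw [ih (by omega)] at this
        exact countermodel_succ this
    rw [hnum n le_rfl] at hu
    generalize v (copy 0 1) = y at hu
    rcases y with c | y
    · exact hu.elim
    · rw [countermodel_standard, standard_graph] at hu
      exact Part.dom_iff_mem.2 ⟨y, hu⟩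
  · obtain ⟨r, hr, rfl⟩ := List.mem_map.1 ht'
    exact absurd (countermodel_rule hr (fun k => v (copy r.tag k)) hroot (hbody r hr))
      (hneg r hr)

theorem Entails.entailsUNA {K : Ontology} {q : Query} (h : Entails K q) : EntailsUNA K q :=
  fun Δ I hI hP _ => h Δ I hI hP

/-! ### Undecidability -/

/-- For fixed `u` only the goal varies with `n`; the rules and their tags are constants. -/
theorem computable_query (u : Code) : Computable (query u) := by
  have hmk : Computable fun p : List (Atom Var) × List (Atom Var) => Query.equiv.symm p :=
    (Primrec.of_equiv_symm (e := Query.equiv)).to_comp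
  have hatom : Primrec fun p : RoleName × Var × Var => (Atom.binary p.1 p.2.1 p.2.2 : Atom Var) :=
    (Primrec.of_equiv_symm (e := Atom.equiv Var)).comp Primrec.sumInr
  have hcopy : Primrec fun k : ℕ => copy 0 k :=
    Primrec₂.natPair.comp (Primrec.const 1) Primrec.id
  have hstep : Primrec fun i : ℕ => Fact.copy 0 (succP, i + 2, i + 3) :=
    hatom.comp (Primrec.pair (Primrec.const _)
      (Primrec.pair (hcopy.comp (Primrec.nat_add.comp Primrec.id (Primrec.const 2)))
        (hcopy.comp (Primrec.nat_add.comp Primrec.id (Primrec.const 3)))))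
  have hval : Primrec fun n : ℕ => Fact.copy 0 (graphP u, n + 2, 1) :=
    hatom.comp (Primrec.pair (Primrec.const _)
      (Primrec.pair (hcopy.comp (Primrec.nat_add.comp Primrec.id (Primrec.const 2)))
        (Primrec.const _)))
  have hgoal : Primrec fun n : ℕ => (goal u n).map (Fact.copy 0) := by
    have : Primrec fun n : ℕ => Fact.copy 0 (zeroP, 0, 2) ::
        Fact.copy 0 (graphP u, n + 2, 1) ::
        (List.range n).map fun i => Fact.copy 0 (succP, i + 2, i + 3) :=
      Primrec.list_cons.comp (Primrec.const _) (Primrec.list_cons.comp hval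
        (Primrec.list_map Primrec.list_range (hstep.comp Primrec.snd).to₂))
    exact this.of_eq fun n => by simp [goal, Function.comp_def]
  have hquery : ∀ A B : List (Atom Var),
      Computable fun n : ℕ => (⟨(goal u n).map (Fact.copy 0) ++ A, B⟩ : Query) := fun A B =>
    hmk.comp (Primrec.pair (Primrec.list_append.comp hgoal (Primrec.const A))
      (Primrec.const B)).to_comp
  exact hquery _ _

/-- A notion of entailment that lies between the two notions is undecidable. -/
theorem not_decidable_of_between {E : Ontology → Query → Prop}
    (h₁ : ∀ K q, Entails K q → E K q) (h₂ : ∀ K q, E K q → EntailsUNA K q) :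
    ¬ DecidableForSafeQueries E := by
  rintro ⟨f, hf, hE⟩
  -- A universal code keeps the ontology fixed: the program to be tested enters only as the numeral
  -- in the query.
  have huniv : Nat.Partrec fun m => (Denumerable.ofNat Code m).eval 0 :=
    Partrec.nat_iff.1 (Code.eval_part.comp (Computable.ofNat Code) (Computable.const 0))
  obtain ⟨u, hu⟩ := Code.exists_code.1 huniv
  refine ComputablePred.halting_problem 0 (ComputablePred.computable_iff.2
    ⟨fun c => f (ontology u, query u (Encodable.encode c)), hf.comp
      ((Computable.const _).pair ((computable_query u).comp Computable.encode)), ?_⟩)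
  funext c
  have hc : u.eval (Encodable.encode c) = c.eval 0 := by
    rw [hu]
    simp
  rw [eq_iff_iff, hE _ _ (query_safe u _), ← hc]
  exact ⟨fun h => h₁ _ _ (entails_of_dom u _ h), fun h => dom_of_entailsUNA u _ (h₂ _ _ h)⟩

end DLLite

theorem theorem2 :
    ¬ DLLite.DecidableForSafeQueries DLLite.Entails ∧
      ¬ DLLite.DecidableForSafeQueries DLLite.EntailsUNA :=
  ⟨DLLite.not_decidable_of_between (fun _ _ h => h) fun _ _ h => h.entailsUNA,
    DLLite.not_decidable_of_between (fun _ _ h => h.entailsUNA) fun _ _ h => h⟩
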